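/- Let $\mu,\xi>0$, and let $(X(t))_{t\ge 0}$ be a continuous-time Markov chain on $\{1,2\}$ with right-continuous paths and generator matrix $$\mathbf Q=\begin{pmatrix}-\mu&\mu\\ \xi&-\xi\end{pmatrix},$$ that is, a time-homogeneous Markov process with transition matrices $e^{t\mathbf Q}$. Let $S_{\mathrm i}=X(0)$ and $S_{\mathrm f}=X(1)$ be the initial and the final state on $[0,1]$, and let $\eta_1=\int_0^1 \mathbf 1_{\{X(t)=1\}}\,dt$ be the time spent in state $1$. For $i,j\in\{1,2\}$ with $\Pr(S_{\mathrm i}=i)>0$, let $f_{\eta_1,S_{\mathrm f}|S_{\mathrm i}}(r,j|i)\,dr$ denote the measure $A\mapsto \Pr(\eta_1\in A,\ S_{\mathrm f}=j\mid S_{\mathrm i}=i)$ on the Borel sets of $\mathbb R$. This measure is concentrated on $[0,1]$ and is given there by $$\begin{aligned} f_{\eta_1,S_{\mathrm f}|S_{\mathrm i}}(r,1|1)&=e^{-\mu r-\xi(1-r)}\left(\delta(1-r)+\sqrt{\frac{\mu\xi r}{1-r}}\;I_1\!\left(2\sqrt{\mu\xi r(1-r)}\right)\right),\\ f_{\eta_1,S_{\mathrm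 f}|S_{\mathrm i}}(r,2|1)&=\mu e^{-\mu r-\xi(1-r)}\,I_0\!\left(2\sqrt{\mu\xi r(1-r)}\right),\\ f_{\eta_1,S_{\mathrm f}|S_{\mathrm i}}(r,1|2)&=\xi e^{-\mu r-\xi(1-r)}\,I_0\!\left(2\sqrt{\mu\xi r(1-r)}\right),\\ f_{\eta_1,S_{\mathrm f}|S_{\mathrm i}}(r,2|2)&=e^{-\mu r-\xi(1-r)}\left(\delta(r)+\sqrt{\frac{\mu\xi(1-r)}{r}}\;I_1\!\left(2\sqrt{\mu\xi r(1-r)}\right)\right), \end{aligned}$$ where $\delta(1-r)$ and $\delta(r)$ stand for the unit point masses at $r=1$ and $r=0$, all other terms are densities with respect to Lebesgue measure on $(0,1)$, and $I_n(x)=\sum_{m\ge 0}\frac{(x/2)^{2m+n}}{m!\,(m+n)!}$ is the modified Bessel function of the first kind of order $n$. -/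

import Mathlib

open MeasureTheory ProbabilityTheory Filter Topology Set
open scoped NNReal ENNReal

/-- `Q` is the infinitesimal generator of a chain on a finite state space: off-diagonal entries
are nonnegative and rows sum to zero. -/
structure IsGenerator {S : Type*} [Fintype S] (Q : Matrix S S ℝ) : Prop where
  offDiag_nonneg : ∀ i j, i ≠ j → 0 ≤ Q i j
  row_sum : ∀ i, ∑ j, Q i j = 0

/-- `X` is a continuous-time Markov chain on the finite state space `S`, with generator `Q` and
arbitrary initial law, under the probability measure `P`: its paths are almost surely
right-continuous step functions, and its finite-dimensional distributions are those of a
time-homogeneous Markov chain with transition matrices `exp (t Q)`. -/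
structure IsCTMC {Ω S : Type*} [MeasurableSpace Ω] [Fintype S] [DecidableEq S]
    [MeasurableSpace S] (Q : Matrix S S ℝ) (X : ℝ≥0 → Ω → S) (P : Measure Ω) : Prop where
  generator : IsGenerator Q
  measurable : ∀ t, Measurable (X t)
  /-- For the discrete topology on `S`, this is right-continuity of the path at every time. -/
  right_continuous : ∀ᵐ ω ∂P, ∀ t : ℝ≥0, ∀ᶠ s in 𝓝[>] t, X s ω = X t ω
  /-- For `t₀ ≤ t₁ ≤ ⋯ ≤ tₙ`, the probability of `X t₀ = x₀, …, X tₙ = xₙ` is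
  `P (X t₀ = x₀)` times the product of the one-step transition probabilities. -/
  markov : ∀ (n : ℕ) (t : Fin (n + 1) → ℝ≥0), Monotone t → ∀ x : Fin (n + 1) → S,
    P.real {ω | ∀ k, X (t k) ω = x k} =
      P.real {ω | X (t 0) ω = x 0} *
        ∏ k : Fin n,
          NormedSpace.exp (((t k.succ : ℝ) - (t k.castSucc : ℝ)) • Q) (x k.castSucc) (x k.succ)

/-- The generator `[[-μ, μ], [ξ, -ξ]]` of a two-state chain.
The first state is `0 : Fin 2`, the second state is `1 : Fin 2`. -/
def twoStateGenerator (μ ξ : ℝ) : Matrix (Fin 2) (Fin 2) ℝ := !![-μ, μ; ξ, -ξ]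

/-- The time that `X` spends in state `i` during `[0, 1]`, defined pathwise. -/
noncomputable def occupationTime {Ω S : Type*} (X : ℝ≥0 → Ω → S) (i : S) (ω : Ω) : ℝ :=
  ∫ t in (0 : ℝ)..1, Set.indicator {s : ℝ | X s.toNNReal ω = i} (fun _ => (1 : ℝ)) t

/-- The joint law of the occupation time of the first state over `[0, 1]` and of the final state,
conditioned on the initial state: the measure
`A ↦ P (η₁ ∈ A, X 1 = j | X 0 = i)` on the real line. -/
noncomputable def occupationLaw {Ω : Type*} [MeasurableSpace Ω] (P : Measure Ω)
    (X : ℝ≥0 → Ω → Fin 2) (i j : Fin 2) : Measure ℝ :=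
  ((ProbabilityTheory.cond P {ω | X 0 ω = i}).restrict {ω | X 1 ω = j}).map (occupationTime X 0)

/-- The modified Bessel function of the first kind `I_n`, of integer order `n ≥ 0`:
`I_n(x) = ∑ₘ (x/2)^(2m+n) / (m! (m+n)!)`. -/
noncomputable def besselI (n : ℕ) (x : ℝ) : ℝ :=
  ∑' m : ℕ, (x / 2) ^ (2 * m + n) / ((m.factorial : ℝ) * ((m + n).factorial : ℝ))

/-! The exponential moments of the occupation time, restricted to given endpoints of the path, are a
Feynman–Kac functional of the chain. Replacing the time integral by Riemann sums turns them into
entries of `(exp (Q / n) * exp (V / n)) ^ n`, so by the product formula the moment generating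
function of the law is an entry of `exp (Q + V)` with `V = diag (s, 0)`. For two states this
exponential is the solution of a linear differential equation, which the transform of the Bessel
densities also satisfies, by the Leibniz rule and the recurrences of the Bessel functions. A finite
measure with finite exponential moments is determined by them. -/

section BesselClifford

/-- The Bessel–Clifford function `C_p(z) = ∑ₘ zᵐ / (m! (m+p)!)`. It is entire and satisfies
`I_p(x) = (x/2)^p C_p(x²/4)`, which makes it a version of the Bessel function that is smooth at the
zeros of `r (1 - r)`. -/
noncomputable def besselClifford (p : ℕ) (z : ℝ) : ℝ :=
  ∑' m : ℕ, z ^ m / ((m.factorial : ℝ) * ((m + p).factorial : ℝ))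

lemma summable_besselClifford (p : ℕ) (z : ℝ) :
    Summable fun m : ℕ => z ^ m / ((m.factorial : ℝ) * ((m + p).factorial : ℝ)) := by
  refine Summable.of_norm_bounded (Real.summable_pow_div_factorial |z|) fun m => ?_
  rw [norm_div, norm_pow, Real.norm_eq_abs, Real.norm_of_nonneg (by positivity)]
  gcongr
  exact le_mul_of_one_le_right (by positivity) (mod_cast Nat.one_le_iff_ne_zero.2 (by positivity))

lemma besselClifford_nonneg (p : ℕ) {z : ℝ} (hz : 0 ≤ z) : 0 ≤ besselClifford p z :=
  tsum_nonneg fun _ => by positivity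

lemma besselClifford_apply_zero (p : ℕ) : besselClifford p 0 = 1 / (p.factorial : ℝ) := by
  rw [besselClifford, tsum_eq_single 0 fun m hm => by simp [hm]]
  simp

lemma hasSum_deriv_besselClifford (p : ℕ) (z : ℝ) :
    HasSum (fun m : ℕ => m * z ^ (m - 1) / ((m.factorial : ℝ) * ((m + p).factorial : ℝ)))
      (besselClifford (p + 1) z) := by
  rw [← hasSum_nat_add_iff' 1]
  convert! (summable_besselClifford (p + 1) z).hasSum using 2 with m
  · rw [Nat.factorial_succ m, show m + 1 + p = m + (p + 1) by ring, Nat.add_sub_cancel]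
    push_cast
    field_simp
  · simp [besselClifford]

lemma hasDerivAt_besselClifford (p : ℕ) (z : ℝ) :
    HasDerivAt (besselClifford p) (besselClifford (p + 1) z) z := by
  set R : ℝ := |z| + 1
  have hR : 0 < R := by positivity
  rw [← (hasSum_deriv_besselClifford p z).tsum_eq]
  refine hasDerivAt_tsum_of_isPreconnected (𝕜 := ℝ) (t := Metric.ball 0 R) (y₀ := 0)
    (g := fun (m : ℕ) z => z ^ m / ((m.factorial : ℝ) * ((m + p).factorial : ℝ)))
    (g' := fun (m : ℕ) z => m * z ^ (m - 1) / ((m.factorial : ℝ) * ((m + p).factorial : ℝ)))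
    (hasSum_deriv_besselClifford p R).summable Metric.isOpen_ball (convex_ball _ _).isPreconnected
    (fun m w _ => (hasDerivAt_pow m w).div_const _) (fun m w hw => ?_) (Metric.mem_ball_self hR)
    (summable_besselClifford p 0) (by simp [R])
  have hwR : ‖w‖ ≤ R := (mem_ball_zero_iff.1 hw).le
  rw [norm_div, norm_mul, norm_pow, Real.norm_of_nonneg (r := (_ : ℝ) * _) (by positivity),
    Real.norm_of_nonneg (r := (m : ℝ)) (by positivity)]
  gcongr

@[fun_prop]
lemma continuous_besselClifford (p : ℕ) : Continuous (besselClifford p) :=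
  continuous_iff_continuousAt.2 fun z => (hasDerivAt_besselClifford p z).continuousAt

lemma besselClifford_eq_add (p : ℕ) (z : ℝ) :
    besselClifford p z = (p + 1) * besselClifford (p + 1) z + z * besselClifford (p + 2) z := by
  refine HasSum.tsum_eq ?_
  convert! ((summable_besselClifford (p + 1) z).hasSum.mul_left ((p : ℝ) + 1)).add
    ((hasSum_deriv_besselClifford (p + 1) z).mul_left z) using 2 with m
  obtain rfl | m := m
  · simp [Nat.factorial_succ, field]
  · simp only [Nat.add_sub_cancel, ← add_assoc, Nat.factorial_succ (m + 1 + p)]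
    push_cast
    field_simp
    ring

lemma besselI_eq_mul_besselClifford (n : ℕ) (x : ℝ) :
    besselI n x = (x / 2) ^ n * besselClifford n ((x / 2) ^ 2) := by
  rw [besselClifford, ← tsum_mul_left]
  exact tsum_congr fun m => by rw [add_comm, pow_add, pow_mul, mul_div_assoc]

@[fun_prop]
lemma continuous_besselI (n : ℕ) : Continuous (besselI n) := by
  simp only [funext (besselI_eq_mul_besselClifford n)]
  fun_prop

lemma besselI_two_mul_sqrt (n : ℕ) {z : ℝ} (hz : 0 ≤ z) :
    besselI n (2 * √z) = √z ^ n * besselClifford n z := by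
  rw [besselI_eq_mul_besselClifford, mul_div_cancel_left₀ _ two_ne_zero, Real.sq_sqrt hz]

lemma sqrt_div_mul_besselI_one {a b : ℝ} (ha : 0 ≤ a) (hb : 0 < b) :
    √(a / b) * besselI 1 (2 * √(a * b)) = a * besselClifford 1 (a * b) := by
  rw [besselI_two_mul_sqrt 1 (by positivity), pow_one, ← mul_assoc,
    ← Real.sqrt_mul (by positivity), show a / b * (a * b) = a ^ 2 by field_simp, Real.sqrt_sq ha]

end BesselClifford

section Calculus

variable {E : Type*} [NormedAddCommGroup E] [NormedSpace ℝ E]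

lemma hasDerivAt_integral_endpoint_of_continuous [CompleteSpace E] {F : ℝ → ℝ → E}
    (hF : Continuous (Function.uncurry F)) (t : ℝ) :
    HasDerivAt (fun s => ∫ r in t..s, F s r) (F t t) t := by
  refine .of_isLittleO (Asymptotics.isLittleO_iff.2 fun ε hε => ?_)
  obtain ⟨δ, hδ, hball⟩ := Metric.continuousAt_iff.1 (hF.continuousAt (x := (t, t))) ε hε
  filter_upwards [Metric.ball_mem_nhds t hδ] with s hs
  have hint : IntervalIntegrable (F s) volume t s :=
    (hF.comp (Continuous.prodMk_right s)).intervalIntegrable t s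
  rw [intervalIntegral.integral_same, sub_zero, ← intervalIntegral.integral_const,
    ← intervalIntegral.integral_sub hint intervalIntegrable_const]
  refine intervalIntegral.norm_integral_le_of_norm_le_const fun r hr => ?_
  have hrs : dist r t ≤ dist s t := by
    simpa only [Real.dist_eq] using abs_sub_left_of_mem_uIcc (uIoc_subset_uIcc hr)
  have hdist : dist (F s r) (F t t) < ε := hball (x := (s, r)) (max_lt hs (hrs.trans_lt hs))
  exact (dist_eq_norm (F s r) (F t t) ▸ hdist).le

lemma hasDerivAt_integral_of_continuous {F F' : ℝ → ℝ → E}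
    (hF : ∀ t, Continuous (F t)) (hF' : Continuous (Function.uncurry F'))
    (hd : ∀ t r, HasDerivAt (fun t => F t r) (F' t r) t) (a b t : ℝ) :
    HasDerivAt (fun t => ∫ r in a..b, F t r) (∫ r in a..b, F' t r) t := by
  obtain ⟨C, hC⟩ := ((isCompact_closedBall t 1).prod (isCompact_uIcc (a := a) (b := b)))
    |>.exists_bound_of_continuousOn hF'.continuousOn
  refine (intervalIntegral.hasDerivAt_integral_of_dominated_loc_of_deriv_le
    (s := Metric.closedBall t 1) (bound := fun _ => C) (Metric.closedBall_mem_nhds t one_pos)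
    (.of_forall fun s => (hF s).aestronglyMeasurable) ((hF t).intervalIntegrable _ _)
    (hF'.comp (Continuous.prodMk_right t)).aestronglyMeasurable
    (ae_of_all _ fun r hr s hs => hC (s, r) ⟨hs, uIoc_subset_uIcc hr⟩) intervalIntegrable_const
    (ae_of_all _ fun r _ s _ => hd s r)).2

lemma hasDerivAt_integral_of_continuous_endpoint [CompleteSpace E] {F F' : ℝ → ℝ → E}
    (hF : Continuous (Function.uncurry F)) (hF' : Continuous (Function.uncurry F'))
    (hd : ∀ t r, HasDerivAt (fun t => F t r) (F' t r) t) (a t : ℝ) :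
    HasDerivAt (fun t => ∫ r in a..t, F t r) (F t t + ∫ r in a..t, F' t r) t := by
  have hFt (s : ℝ) : Continuous (F s) := hF.comp (Continuous.prodMk_right s)
  have hsplit : (fun s => ∫ r in a..s, F s r) =
      fun s => (∫ r in t..s, F s r) + ∫ r in a..t, F s r := funext fun s => by
    rw [add_comm, intervalIntegral.integral_add_adjacent_intervals] <;>
      exact (hFt s).intervalIntegrable _ _
  rw [hsplit]
  exact (hasDerivAt_integral_endpoint_of_continuous hF t).add
    (hasDerivAt_integral_of_continuous hFt hF' hd a t t)

lemma eq_exp_smul_mul_of_hasDerivAt {𝔸 : Type*} [NormedRing 𝔸] [NormedAlgebra ℝ 𝔸]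
    [CompleteSpace 𝔸] {A : 𝔸} {F : ℝ → 𝔸} (hF : ∀ t, HasDerivAt F (A * F t) t) (t : ℝ) :
    F t = NormedSpace.exp (t • A) * F 0 := by
  have hd (s : ℝ) : HasDerivAt (fun s => NormedSpace.exp ((t - s) • A) * F s) 0 s := by
    refine (((hasDerivAt_exp_smul_const (𝕂 := ℝ) A (t - s)).scomp s
      ((hasDerivAt_id s).const_sub t)).mul (hF s)).congr_deriv ?_
    simp [mul_assoc]
  simpa [NormedSpace.exp_zero] using is_const_of_deriv_eq_zero (fun s => (hd s).differentiableAt)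
    (fun s => (hd s).deriv) t 0

end Calculus

section TwoByTwoExponential

variable (x y c t : ℝ)

/-- The off-diagonal entry, up to a constant factor, of the exponential of `t • !![x, μ; ξ, y]`
with `c = μ ξ`. The variable of integration is the time a path of length `t` spends in the first
state, where it grows at rate `x`. -/
noncomputable def switchIntegral : ℝ :=
  ∫ r in 0..t, Real.exp (x * r + y * (t - r)) * besselClifford 0 (c * r * (t - r))

/-- The first diagonal entry of the exponential of `t • !![x, μ; ξ, y]` with `c = μ ξ`. The variable
of integration is the time a path of length `t` spends in the second state; the path that never
leaves the first state contributes the term `exp (x t)`. -/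
noncomputable def returnIntegral : ℝ :=
  Real.exp (x * t) + ∫ r in 0..t,
    c * (t - r) * (Real.exp (y * r + x * (t - r)) * besselClifford 1 (c * r * (t - r)))

lemma switchIntegral_swap : switchIntegral y x c t = switchIntegral x y c t := by
  have hreflect := intervalIntegral.integral_comp_sub_left (a := 0) (b := t)
    (fun r => Real.exp (x * r + y * (t - r)) * besselClifford 0 (c * r * (t - r))) t
  rw [sub_self, sub_zero] at hreflect
  simp only [switchIntegral, ← hreflect, sub_sub_cancel, mul_right_comm c, add_comm]

lemma returnIntegral_eq_reflect : returnIntegral x y c t = Real.exp (x * t) + ∫ r in 0..t,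
    c * r * (Real.exp (x * r + y * (t - r)) * besselClifford 1 (c * r * (t - r))) := by
  have hreflect := intervalIntegral.integral_comp_sub_left (a := 0) (b := t)
    (fun r => c * r * (Real.exp (x * r + y * (t - r)) * besselClifford 1 (c * r * (t - r)))) t
  rw [sub_self, sub_zero] at hreflect
  simp only [returnIntegral, ← hreflect, sub_sub_cancel, mul_right_comm c, add_comm]

lemma hasDerivAt_exp_mul_besselClifford (p : ℕ) (r : ℝ) :
    HasDerivAt (fun t => Real.exp (x * r + y * (t - r)) * besselClifford p (c * r * (t - r)))
      (Real.exp (x * r + y * (t - r)) *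
        (y * besselClifford p (c * r * (t - r)) +
          c * r * besselClifford (p + 1) (c * r * (t - r)))) t := by
  have hlin : HasDerivAt (fun t : ℝ => t - r) 1 t := (hasDerivAt_id t).sub_const r
  refine (((hlin.const_mul y).const_add (x * r)).exp.mul
    ((hasDerivAt_besselClifford p _).comp t (hlin.const_mul (c * r)))).congr_deriv ?_
  simp only [Function.comp_apply]
  ring

lemma hasDerivAt_switchIntegral :
    HasDerivAt (switchIntegral x y c) (returnIntegral x y c t + y * switchIntegral x y c t) t := by
  refine (hasDerivAt_integral_of_continuous_endpoint
    (by unfold Function.uncurry; fun_prop) (by unfold Function.uncurry; fun_prop)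
    (fun t r => hasDerivAt_exp_mul_besselClifford x y c t 0 r) 0 t).congr_deriv ?_
  have hboundary : Real.exp (x * t + y * (t - t)) * besselClifford 0 (c * t * (t - t)) =
      Real.exp (x * t) := by simp [besselClifford_apply_zero]
  rw [hboundary, returnIntegral_eq_reflect, switchIntegral, add_assoc,
    ← intervalIntegral.integral_const_mul, ← intervalIntegral.integral_add
      (Continuous.intervalIntegrable (by fun_prop) _ _)
      (Continuous.intervalIntegrable (by fun_prop) _ _)]
  congr! 3
  ring

lemma hasDerivAt_returnIntegral :
    HasDerivAt (returnIntegral x y c) (x * returnIntegral x y c t + c * switchIntegral x y c t)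
      t := by
  have hexp : HasDerivAt (fun t => Real.exp (x * t)) (x * Real.exp (x * t)) t := by
    simpa [mul_comm] using ((hasDerivAt_id t).const_mul x).exp
  have hkernel (t r : ℝ) :
      HasDerivAt (fun t => c * (t - r) *
          (Real.exp (y * r + x * (t - r)) * besselClifford 1 (c * r * (t - r))))
        (x * (c * (t - r) *
            (Real.exp (y * r + x * (t - r)) * besselClifford 1 (c * r * (t - r)))) +
          c * (Real.exp (y * r + x * (t - r)) * besselClifford 0 (c * r * (t - r)))) t := by
    refine ((((hasDerivAt_id t).sub_const r).const_mul c).mul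
      (hasDerivAt_exp_mul_besselClifford y x c t 1 r)).congr_deriv ?_
    rw [besselClifford_eq_add 0]
    simp only [id]
    push_cast
    ring
  refine (hexp.add (hasDerivAt_integral_of_continuous_endpoint
    (by unfold Function.uncurry; fun_prop) (by unfold Function.uncurry; fun_prop)
    hkernel 0 t)).congr_deriv ?_
  rw [returnIntegral, ← switchIntegral_swap, switchIntegral, mul_add, add_assoc, sub_self,
    mul_zero, zero_mul, zero_add, ← intervalIntegral.integral_const_mul,
    ← intervalIntegral.integral_const_mul, ← intervalIntegral.integral_add
      (Continuous.intervalIntegrable (by fun_prop) _ _)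
      (Continuous.intervalIntegrable (by fun_prop) _ _)]

open scoped Matrix.Norms.Operator in
lemma exp_smul_two_by_two (μ ξ : ℝ) :
    NormedSpace.exp (t • !![x, μ; ξ, y]) =
      !![returnIntegral x y (μ * ξ) t, μ * switchIntegral x y (μ * ξ) t;
        ξ * switchIntegral x y (μ * ξ) t, returnIntegral y x (μ * ξ) t] := by
  set F : ℝ → Matrix (Fin 2) (Fin 2) ℝ := fun t =>
    !![returnIntegral x y (μ * ξ) t, μ * switchIntegral x y (μ * ξ) t;
      ξ * switchIntegral x y (μ * ξ) t, returnIntegral y x (μ * ξ) t]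
  have hd (t : ℝ) : HasDerivAt F (!![x, μ; ξ, y] * F t) t := by
    have hswap := hasDerivAt_switchIntegral y x (μ * ξ) t
    simp only [funext (switchIntegral_swap x y (μ * ξ)), switchIntegral_swap x y] at hswap
    refine hasDerivAt_pi.2 fun i => hasDerivAt_pi.2 fun j => ?_
    fin_cases i <;> fin_cases j
    · refine (hasDerivAt_returnIntegral x y (μ * ξ) t).congr_deriv ?_
      simp [F, Matrix.mul_apply]
      ring
    · refine (hswap.const_mul μ).congr_deriv ?_
      simp [F, Matrix.mul_apply]
      ring
    · refine ((hasDerivAt_switchIntegral x y (μ * ξ) t).const_mul ξ).congr_deriv ?_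
      simp [F, Matrix.mul_apply]
      ring
    · refine (hasDerivAt_returnIntegral y x (μ * ξ) t).congr_deriv ?_
      simp [F, Matrix.mul_apply, switchIntegral_swap x y]
      ring
  have h0 : F 0 = 1 := by simp [F, returnIntegral, switchIntegral, Matrix.one_fin_two]
  have hexp := eq_exp_smul_mul_of_hasDerivAt hd t
  rw [h0, mul_one] at hexp
  exact hexp.symm

end TwoByTwoExponential

section ProductFormula

variable {𝔸 : Type*} [NormedRing 𝔸]

lemma norm_pow_sub_pow_le [NormOneClass 𝔸] {A B : 𝔸} {c : ℝ} (hA : ‖A‖ ≤ c) (hB : ‖B‖ ≤ c)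
    (n : ℕ) : ‖A ^ n - B ^ n‖ ≤ n * c ^ (n - 1) * ‖A - B‖ := by
  have hc : 0 ≤ c := (norm_nonneg A).trans hA
  obtain _ | n := n
  · simp
  induction n with
  | zero => simp
  | succ n ih =>
    calc ‖A ^ (n + 2) - B ^ (n + 2)‖
        = ‖A ^ (n + 1) * (A - B) + (A ^ (n + 1) - B ^ (n + 1)) * B‖ := by
          congr 1
          noncomm_ring
      _ ≤ ‖A ^ (n + 1)‖ * ‖A - B‖ + ‖A ^ (n + 1) - B ^ (n + 1)‖ * ‖B‖ :=
          (norm_add_le _ _).trans (add_le_add (norm_mul_le _ _) (norm_mul_le _ _))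
      _ ≤ c ^ (n + 1) * ‖A - B‖ + (↑(n + 1) * c ^ n * ‖A - B‖) * c := by
          gcongr
          · exact (norm_pow_le A _).trans (by gcongr)
          · exact ih
      _ = ↑(n + 1 + 1) * c ^ (n + 1) * ‖A - B‖ := by
          push_cast
          ring

lemma norm_pow_sub_pow_le_exp_mul [NormOneClass 𝔸] {A B : 𝔸} {K t : ℝ} (hK : 0 ≤ K) {n : ℕ}
    (hn : n ≠ 0) (hA : ‖A‖ ≤ Real.exp (K * |t / n|)) (hB : ‖B‖ ≤ Real.exp (K * |t / n|)) :
    ‖A ^ n - B ^ n‖ ≤ Real.exp (K * |t|) * (n * ‖A - B‖) := by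
  have hpow : Real.exp (K * |t / n|) ^ (n - 1) ≤ Real.exp (K * |t|) := by
    refine (pow_le_pow_right₀ (Real.one_le_exp (mul_nonneg hK (abs_nonneg _))) n.pred_le).trans ?_
    rw [← Real.exp_nat_mul, abs_div, Nat.abs_cast, mul_left_comm,
      mul_div_cancel₀ _ (Nat.cast_ne_zero.2 hn)]
  calc ‖A ^ n - B ^ n‖ ≤ n * Real.exp (K * |t / n|) ^ (n - 1) * ‖A - B‖ :=
        norm_pow_sub_pow_le hA hB n
    _ ≤ n * Real.exp (K * |t|) * ‖A - B‖ := by gcongr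
    _ = Real.exp (K * |t|) * (n * ‖A - B‖) := by ring

variable [NormedAlgebra ℝ 𝔸]

lemma exists_norm_le_exp_of_hasDerivAt [NormOneClass 𝔸] {F : ℝ → 𝔸} {C : 𝔸} (h0 : F 0 = 1)
    (hF : HasDerivAt F C 0) : ∃ K : ℝ, 0 ≤ K ∧ ∀ᶠ h in 𝓝 0, ‖F h‖ ≤ Real.exp (K * |h|) := by
  obtain ⟨K, hK0, hK⟩ := hF.isBigO_sub.exists_nonneg
  refine ⟨K, hK0, hK.bound.mono fun h hh => ?_⟩
  rw [h0, sub_zero, Real.norm_eq_abs] at hh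
  calc ‖F h‖ ≤ ‖F h - 1‖ + ‖(1 : 𝔸)‖ := norm_le_norm_sub_add _ _
    _ ≤ K * |h| + 1 := by gcongr; exact norm_one.le
    _ ≤ Real.exp (K * |h|) := Real.add_one_le_exp _

/-- Chernoff's product formula. Telescoping bounds `F (t / n) ^ n - exp (t C)` by a multiple of
`n (F (t / n) - exp ((t / n) C))`, and `F` agrees with the exponential to first order. -/
lemma tendsto_pow_div_of_hasDerivAt [NormOneClass 𝔸] [CompleteSpace 𝔸] {F : ℝ → 𝔸} {C : 𝔸}
    (h0 : F 0 = 1) (hF : HasDerivAt F C 0) (t : ℝ) :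
    Tendsto (fun n : ℕ => F (t / n) ^ n) atTop (𝓝 (NormedSpace.exp (t • C))) := by
  set G : ℝ → 𝔸 := fun h => NormedSpace.exp (h • C) with hG
  have hG0 : G 0 = 1 := by simp [hG, NormedSpace.exp_zero]
  have hGd : HasDerivAt G C 0 := by
    simpa [NormedSpace.exp_zero] using hasDerivAt_exp_smul_const (𝕂 := ℝ) C 0
  have hstep : Tendsto (fun n : ℕ => t / n) atTop (𝓝 0) := tendsto_const_div_atTop_nhds_zero_nat t
  have hGpow : (fun n : ℕ => G (t / n) ^ n) =ᶠ[atTop] fun _ => NormedSpace.exp (t • C) := by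
    filter_upwards [eventually_ne_atTop 0] with n hn
    let _ : NormedAlgebra ℚ 𝔸 := NormedAlgebra.restrictScalars ℚ ℝ 𝔸
    rw [hG, ← NormedSpace.exp_nsmul, ← Nat.cast_smul_eq_nsmul ℝ, smul_smul,
      mul_div_cancel₀ _ (Nat.cast_ne_zero.2 hn)]
  obtain ⟨K, hK0, hK⟩ := exists_norm_le_exp_of_hasDerivAt h0 hF
  obtain ⟨L, _, hL⟩ := exists_norm_le_exp_of_hasDerivAt hG0 hGd
  set M := max K L
  have hbound : ∀ᶠ n : ℕ in atTop, ‖F (t / n) ^ n - G (t / n) ^ n‖ ≤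
      Real.exp (M * |t|) * (n * ‖F (t / n) - G (t / n)‖) := by
    filter_upwards [hstep.eventually hK, hstep.eventually hL, eventually_ne_atTop 0]
      with n hFn hGn hn
    exact norm_pow_sub_pow_le_exp_mul (hK0.trans (le_max_left K L)) hn
      (hFn.trans (by gcongr; exact le_max_left K L))
      (hGn.trans (by gcongr; exact le_max_right K L))
  have hdiff : Tendsto (fun n : ℕ => n * ‖F (t / n) - G (t / n)‖) atTop (𝓝 0) := by
    have hFG : (fun h => F h - G h) =o[𝓝 0] fun h : ℝ => h := by
      simpa [h0, hG0] using (hF.sub hGd).isLittleO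
    have hO : (fun n : ℕ => t / (n : ℝ)) =O[atTop] fun n : ℕ => (n : ℝ)⁻¹ :=
      Asymptotics.isBigO_const_mul_self t _ _
    simpa [mul_comm] using
      ((hFG.comp_tendsto hstep).trans_isBigO hO).norm_left.tendsto_div_nhds_zero
  have hlim : Tendsto (fun n : ℕ => F (t / n) ^ n - G (t / n) ^ n) atTop (𝓝 0) :=
    squeeze_zero_norm' hbound (by simpa using hdiff.const_mul (Real.exp (M * |t|)))
  simpa using hlim.add (tendsto_const_nhds.congr' hGpow.symm)

lemma tendsto_exp_mul_exp_pow_div [NormOneClass 𝔸] [CompleteSpace 𝔸] (A B : 𝔸) (t : ℝ) :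
    Tendsto (fun n : ℕ => (NormedSpace.exp ((t / n) • A) * NormedSpace.exp ((t / n) • B)) ^ n) atTop
      (𝓝 (NormedSpace.exp (t • (A + B)))) :=
  tendsto_pow_div_of_hasDerivAt
    (F := fun h => NormedSpace.exp (h • A) * NormedSpace.exp (h • B))
    (by simp [NormedSpace.exp_zero])
    (((hasDerivAt_exp_smul_const (𝕂 := ℝ) A 0).mul
      (hasDerivAt_exp_smul_const (𝕂 := ℝ) B 0)).congr_deriv (by simp [NormedSpace.exp_zero])) t

end ProductFormula

section RiemannSums

variable {E : Type*} [NormedAddCommGroup E] [NormedSpace ℝ E]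

lemma integral_comp_natCeil_div [CompleteSpace E] (u : ℕ → E) {h : ℝ} (hh : 0 < h) (n : ℕ) :
    ∫ t in 0..n * h, u ⌈t / h⌉₊ = h • ∑ k ∈ Finset.range n, u (k + 1) := by
  have hstep (k : ℕ) : EqOn (fun _ => u (k + 1)) (fun t => u ⌈t / h⌉₊)
      (uIoc (k * h) ((k + 1 : ℕ) * h)) := by
    intro t ht
    rw [uIoc_of_le (by gcongr; exact k.le_succ), mem_Ioc, ← lt_div_iff₀ hh, ← div_le_iff₀ hh] at ht
    have hceil : ⌈t / h⌉₊ = k + 1 := (Nat.ceil_eq_iff k.succ_ne_zero).2 ht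
    simp only [hceil]
  have hsum := intervalIntegral.sum_integral_adjacent_intervals (μ := volume)
    (f := fun t => u ⌈t / h⌉₊) (a := fun k : ℕ => k * h) (n := n)
    fun k _ => intervalIntegrable_const.congr (hstep k)
  rw [Nat.cast_zero, zero_mul] at hsum
  rw [← hsum, Finset.smul_sum]
  refine Finset.sum_congr rfl fun k _ => ?_
  rw [← intervalIntegral.integral_congr_ae (ae_of_all _ (hstep k)),
    intervalIntegral.integral_const, ← sub_mul]
  simp

lemma smul_sum_range_le_mul {u : ℕ → ℝ} {T C : ℝ} (hT : 0 ≤ T) (hC : 0 ≤ C) (hu : ∀ k, u k ≤ C)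
    (n : ℕ) : (T / n) • ∑ k ∈ Finset.range n, u k ≤ T * C := by
  calc (T / n) • ∑ k ∈ Finset.range n, u k ≤ (T / n) • ∑ _k ∈ Finset.range n, C := by
        gcongr with k
        exact hu k
    _ = T * (n / n) * C := by
        rw [Finset.sum_const, Finset.card_range, nsmul_eq_mul, smul_eq_mul]
        ring
    _ ≤ T * C := by
        gcongr
        exact mul_le_of_le_one_right hT (div_self_le_one _)

lemma tendsto_natCeil_div_mul {T : ℝ} (hT : 0 < T) {t : ℝ} (ht : 0 ≤ t) :
    Tendsto (fun n : ℕ => ⌈t / (T / n)⌉₊ * (T / n)) atTop (𝓝[≥] t) := by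
  refine tendsto_nhdsWithin_iff.2 ⟨?_, ?_⟩
  · have hceil := ((tendsto_nat_ceil_mul_div_atTop (R := ℝ) (div_nonneg ht hT.le)).comp
      (tendsto_natCast_atTop_atTop (R := ℝ))).mul_const T
    rw [div_mul_cancel₀ t hT.ne'] at hceil
    refine hceil.congr fun n => ?_
    rw [Function.comp_apply, div_div_eq_mul_div, div_mul_eq_mul_div t, div_mul_eq_mul_div,
      mul_div_assoc]
  · filter_upwards [eventually_gt_atTop 0] with n hn
    have hstep : 0 < T / n := by positivity
    exact (div_le_iff₀ hstep).1 (Nat.le_ceil _)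

lemma tendsto_riemannSum_of_continuousWithinAt_Ici [CompleteSpace E] {g : ℝ → E} {C T : ℝ}
    (hT : 0 ≤ T) (hC : ∀ t, ‖g t‖ ≤ C)
    (hg : ∀ t ∈ Ioc 0 T, ContinuousWithinAt g (Ici t) t) :
    Tendsto (fun n : ℕ => (T / n) • ∑ k ∈ Finset.range n, g ((k + 1 : ℕ) * (T / n))) atTop
      (𝓝 (∫ t in 0..T, g t)) := by
  obtain rfl | hT := hT.eq_or_lt
  · simp
  have hlim : Tendsto (fun n : ℕ => ∫ t in 0..T, g (⌈t / (T / n)⌉₊ * (T / n))) atTop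
      (𝓝 (∫ t in 0..T, g t)) := by
    refine intervalIntegral.tendsto_integral_filter_of_dominated_convergence (fun _ => C)
      (.of_forall fun n => ?_) (.of_forall fun n => ae_of_all _ fun t _ => hC _)
      intervalIntegrable_const (ae_of_all _ fun t ht => ?_)
    · exact ((StronglyMeasurable.of_discrete (f := fun k : ℕ => g (k * (T / n)))).comp_measurable
        (Nat.measurable_ceil.comp (measurable_id.div_const _))).aestronglyMeasurable
    · rw [uIoc_of_le hT.le] at ht
      exact (hg t ht).tendsto.comp (tendsto_natCeil_div_mul hT ht.1.le)
  refine hlim.congr' ?_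
  filter_upwards [eventually_gt_atTop 0] with n hn
  have hn' : (0 : ℝ) < n := Nat.cast_pos.2 hn
  rw [← integral_comp_natCeil_div (fun k => g (k * (T / n))) (by positivity),
    mul_div_cancel₀ _ hn'.ne']

end RiemannSums

section FeynmanKac

lemma matrix_pow_apply_eq_sum_paths {S R : Type*} [Fintype S] [DecidableEq S] [CommSemiring R]
    (M : Matrix S S R) (n : ℕ) (i j : S) :
    (M ^ n) i j = ∑ x : Fin (n + 1) → S, if x 0 = i ∧ x (Fin.last n) = j then
      ∏ k : Fin n, M (x k.castSucc) (x k.succ) else 0 := by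
  induction n generalizing i with
  | zero =>
    rw [← (Equiv.funUnique (Fin 1) S).symm.sum_comp, pow_zero, Matrix.one_apply,
      Finset.sum_eq_single i (fun b _ hb => by simp [Equiv.funUnique, hb]) (by simp)]
    simp [Equiv.funUnique]
  | succ n ih =>
    rw [pow_succ', Matrix.mul_apply, ← (Fin.consEquiv fun _ => S).sum_comp, Fintype.sum_prod_type]
    simp only [ih, Finset.mul_sum, Fin.consEquiv_apply, Fin.cons_zero, Fin.prod_univ_succ,
      Fin.castSucc_zero, ← Fin.succ_last, Fin.cons_succ, ← Fin.succ_castSucc]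
    rw [Finset.sum_comm, Finset.sum_eq_single i (fun b _ hb => by simp [hb]) (by simp)]
    refine Finset.sum_congr rfl fun x _ => ?_
    rw [Finset.sum_eq_single (x 0) (fun b _ hb => by simp [hb.symm]) (by simp)]
    simp

variable {Ω S E : Type*} [MeasurableSpace Ω] [Fintype S] [DecidableEq S] [MeasurableSpace S]
  [NormedAddCommGroup E] [NormedSpace ℝ E] [CompleteSpace E]
  {Q : Matrix S S ℝ} {X : ℝ≥0 → Ω → S} {P : Measure Ω}

namespace IsCTMC

lemma integral_comp_skeleton [MeasurableSingletonClass S] [IsFiniteMeasure P] (hX : IsCTMC Q X P)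
    {n : ℕ} {t : Fin (n + 1) → ℝ≥0} (ht : Monotone t) (G : (Fin (n + 1) → S) → E) :
    ∫ ω, G (fun k => X (t k) ω) ∂P = ∑ x, (P.real {ω | X (t 0) ω = x 0} * ∏ k : Fin n,
      NormedSpace.exp (((t k.succ : ℝ) - t k.castSucc) • Q) (x k.castSucc) (x k.succ)) • G x := by
  have hY : Measurable fun ω k => X (t k) ω := measurable_pi_lambda _ fun k => hX.measurable _
  rw [← integral_map (f := G) hY.aemeasurable .of_discrete, integral_fintype .of_finite]
  refine Finset.sum_congr rfl fun x _ => ?_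
  rw [← hX.markov n t ht x, map_measureReal_apply hY (measurableSet_singleton x)]
  simp only [preimage, mem_singleton_iff, funext_iff]

lemma measurableSet_endpoints [MeasurableSingletonClass S] (hX : IsCTMC Q X P) (T : ℝ≥0)
    (i j : S) : MeasurableSet {ω | X 0 ω = i ∧ X T ω = j} :=
  (hX.measurable 0 (measurableSet_singleton i)).inter (hX.measurable T (measurableSet_singleton j))

lemma setIntegral_prod_skeleton [MeasurableSingletonClass S] [IsFiniteMeasure P]
    (hX : IsCTMC Q X P) (f : S → ℝ) (h : ℝ≥0) (n : ℕ) (i j : S) :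
    ∫ ω in {ω | X 0 ω = i ∧ X (n * h) ω = j},
        ∏ k ∈ Finset.range n, f (X ((k + 1 : ℕ) * h) ω) ∂P =
      P.real {ω | X 0 ω = i} *
        ((NormedSpace.exp ((h : ℝ) • Q) * Matrix.diagonal f) ^ n) i j := by
  set t : Fin (n + 1) → ℝ≥0 := fun k => (k : ℕ) * h with ht
  have ht0 : t 0 = 0 := by simp [ht]
  have hmono : Monotone t := fun a b hab => by
    simp only [ht]
    gcongr
    exact hab
  have hstep (k : Fin n) : (t k.succ : ℝ) - t k.castSucc = h := by
    simp [ht]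
    ring
  have hskeleton := hX.integral_comp_skeleton hmono fun x =>
    if x 0 = i ∧ x (Fin.last n) = j then ∏ k : Fin n, f (x k.succ) else 0
  rw [← integral_indicator (hX.measurableSet_endpoints _ i j), matrix_pow_apply_eq_sum_paths,
    Finset.mul_sum]
  convert hskeleton using 2 with ω
  · simp [indicator_apply, ht, Finset.prod_range]
  · simp only [hstep, ht0, Matrix.mul_diagonal, Finset.prod_mul_distrib]
    split_ifs with hends
    · rw [hends.1, smul_eq_mul, mul_assoc]
    · simp

lemma tendsto_riemannSum (hX : IsCTMC Q X P) (V : S → E) (T : ℝ≥0) : ∀ᵐ ω ∂P,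
    Tendsto (fun n : ℕ =>
        (T / n : ℝ) • ∑ k ∈ Finset.range n, V (X ((k + 1 : ℕ) * (T / n)) ω)) atTop
      (𝓝 (∫ t in 0..(T : ℝ), V (X t.toNNReal ω))) := by
  filter_upwards [hX.right_continuous] with ω hω
  have hright (t : ℝ) : ContinuousWithinAt (fun t : ℝ => V (X t.toNNReal ω)) (Ici t) t := by
    have hconst : ∀ᶠ s in 𝓝[≥] t.toNNReal, X s ω = X t.toNNReal ω := by
      rw [← Ioi_insert, nhdsWithin_insert]
      exact eventually_sup.2 ⟨by simp, hω _⟩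
    have hlift : Tendsto Real.toNNReal (𝓝[≥] t) (𝓝[≥] t.toNNReal) :=
      continuous_real_toNNReal.continuousWithinAt.tendsto_nhdsWithin
        fun _ hs => Real.toNNReal_le_toNNReal hs
    refine tendsto_const_nhds.congr' ?_
    filter_upwards [hlift.eventually hconst] with s hs
    rw [hs]
  refine (tendsto_riemannSum_of_continuousWithinAt_Ici T.coe_nonneg
    (fun t => norm_le_pi_norm V (X t.toNNReal ω)) fun t _ => hright t).congr fun n => ?_
  congr! with k
  rw [← Real.toNNReal_coe (r := (k + 1 : ℕ) * (T / n))]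
  push_cast
  rfl

lemma measurable_riemannSum [MeasurableSingletonClass S] (hX : IsCTMC Q X P) (V : S → ℝ)
    (T : ℝ≥0) (n : ℕ) : Measurable fun ω =>
      (T / n : ℝ) • ∑ k ∈ Finset.range n, V (X ((k + 1 : ℕ) * (T / n)) ω) := by
  have hV (s : ℝ≥0) : Measurable fun ω => V (X s ω) :=
    (measurable_of_finite V).comp (hX.measurable s)
  exact (Finset.measurable_fun_sum _ fun k _ => hV _).const_smul (T / n : ℝ)

lemma aemeasurable_integral [MeasurableSingletonClass S] (hX : IsCTMC Q X P) (V : S → ℝ)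
    (T : ℝ≥0) : AEMeasurable (fun ω => ∫ t in 0..(T : ℝ), V (X t.toNNReal ω)) P :=
  aemeasurable_of_tendsto_metrizable_ae atTop
    (fun n => (hX.measurable_riemannSum V T n).aemeasurable) (hX.tendsto_riemannSum V T)

lemma setIntegral_exp_riemannSum [MeasurableSingletonClass S] [IsFiniteMeasure P]
    (hX : IsCTMC Q X P) (V : S → ℝ) (T : ℝ≥0) {n : ℕ} (hn : n ≠ 0) (i j : S) :
    ∫ ω in {ω | X 0 ω = i ∧ X T ω = j}, Real.exp
        ((T / n : ℝ) • ∑ k ∈ Finset.range n, V (X ((k + 1 : ℕ) * (T / n)) ω)) ∂P =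
      P.real {ω | X 0 ω = i} * ((NormedSpace.exp ((T / n : ℝ) • Q) *
        NormedSpace.exp ((T / n : ℝ) • Matrix.diagonal V)) ^ n) i j := by
  have hexp : NormedSpace.exp ((T / n : ℝ) • Matrix.diagonal V) =
      Matrix.diagonal fun k => Real.exp (T / n * V k) := by
    rw [← Matrix.diagonal_smul, Matrix.exp_diagonal, Pi.exp_def, Real.exp_eq_exp_ℝ]
    rfl
  have hdiscrete := hX.setIntegral_prod_skeleton (fun k => Real.exp (T / n * V k)) (T / n) n i j
  rw [mul_div_cancel₀ T (Nat.cast_ne_zero.2 hn)] at hdiscrete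
  simpa only [hexp, smul_eq_mul, Finset.mul_sum, Real.exp_sum, NNReal.coe_div,
    NNReal.coe_natCast] using hdiscrete

open scoped Matrix.Norms.Operator in
theorem feynmanKac [MeasurableSingletonClass S] [IsFiniteMeasure P] (hX : IsCTMC Q X P)
    (V : S → ℝ) (T : ℝ≥0) (i j : S) :
    ∫ ω in {ω | X 0 ω = i ∧ X T ω = j}, Real.exp (∫ t in 0..(T : ℝ), V (X t.toNNReal ω)) ∂P =
      P.real {ω | X 0 ω = i} * NormedSpace.exp ((T : ℝ) • (Q + Matrix.diagonal V)) i j := by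
  have : Nonempty S := ⟨i⟩
  have hbound (n : ℕ) (ω : Ω) :
      (T / n : ℝ) • ∑ k ∈ Finset.range n, V (X ((k + 1 : ℕ) * (T / n)) ω) ≤ T * ‖V‖ :=
    smul_sum_range_le_mul T.coe_nonneg (norm_nonneg V)
      (fun k => (Real.le_norm_self _).trans (norm_le_pi_norm V _)) n
  have hpaths := tendsto_integral_of_dominated_convergence
    (μ := P.restrict {ω | X 0 ω = i ∧ X T ω = j})
    (F := fun (n : ℕ) ω => Real.exp
      ((T / n : ℝ) • ∑ k ∈ Finset.range n, V (X ((k + 1 : ℕ) * (T / n)) ω)))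
    (fun _ => Real.exp (T * ‖V‖))
    (fun n => (hX.measurable_riemannSum V T n).exp.aestronglyMeasurable)
    (integrable_const _)
    (fun n => ae_of_all _ fun ω => by
      rw [Real.norm_eq_abs, Real.abs_exp]
      exact Real.exp_le_exp.2 (hbound n ω))
    ((ae_restrict_of_ae (hX.tendsto_riemannSum V T)).mono fun ω hω => hω.rexp)
  have hmatrix := (((tendsto_exp_mul_exp_pow_div Q (Matrix.diagonal V) T).apply_nhds i).apply_nhds
    j).const_mul (P.real {ω | X 0 ω = i})
  refine tendsto_nhds_unique hpaths (hmatrix.congr' ?_)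
  filter_upwards [eventually_ne_atTop 0] with n hn
  exact (hX.setIntegral_exp_riemannSum V T hn i j).symm

end IsCTMC

end FeynmanKac

section OccupationLaw

lemma occupationTime_mem_Icc {Ω S : Type*} (X : ℝ≥0 → Ω → S) (i : S) (ω : Ω) :
    occupationTime X i ω ∈ Icc (0 : ℝ) 1 := by
  refine ⟨intervalIntegral.integral_nonneg zero_le_one fun t _ =>
    indicator_nonneg (fun _ _ => zero_le_one) t, ?_⟩
  have hle := intervalIntegral.norm_integral_le_of_norm_le_const (a := 0) (b := 1) (C := 1)
    (f := indicator {s : ℝ | X s.toNNReal ω = i} fun _ => (1 : ℝ))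
    fun t _ => (norm_indicator_le_norm_self _ _).trans norm_one.le
  rw [sub_zero, abs_one, mul_one] at hle
  exact (Real.le_norm_self _).trans hle

lemma mul_occupationTime_eq_integral {Ω S : Type*} [DecidableEq S] (X : ℝ≥0 → Ω → S) (i : S)
    (s : ℝ) (ω : Ω) :
    s * occupationTime X i ω =
      ∫ t in (0 : ℝ)..1, (Pi.single i s : S → ℝ) (X t.toNNReal ω) := by
  rw [occupationTime, ← intervalIntegral.integral_const_mul]
  simp only [indicator_apply, mem_ofPred_eq, Pi.single_apply, mul_ite, mul_one, mul_zero]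

lemma measure_ext_of_mgf_id_eq {ν ν' : Measure ℝ} [IsFiniteMeasure ν] [IsFiniteMeasure ν']
    (hint : ∀ s : ℝ, Integrable (fun x => Real.exp (s * x)) ν) (h : mgf id ν = mgf id ν') :
    ν = ν' := by
  have hzero : ν = 0 ↔ ν' = 0 := by
    have hmass := congr_fun h 0
    simp only [mgf_zero'] at hmass
    rw [← Measure.measure_univ_eq_zero, ← Measure.measure_univ_eq_zero,
      ← measureReal_eq_zero_iff, ← measureReal_eq_zero_iff, hmass]
  have huniv : integrableExpSet id ν = univ := eq_univ_of_forall hint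
  exact Measure.ext_of_complexMGF_id_eq (funext fun z =>
    eqOn_complexMGF_of_mgf' h hzero (by simp [huniv]))

namespace IsCTMC

lemma aemeasurable_occupationTime {Ω S : Type*} [MeasurableSpace Ω] [Fintype S] [DecidableEq S]
    [MeasurableSpace S] [MeasurableSingletonClass S] {Q : Matrix S S ℝ} {X : ℝ≥0 → Ω → S}
    {P : Measure Ω} (hX : IsCTMC Q X P) (i : S) : AEMeasurable (occupationTime X i) P := by
  have h := hX.aemeasurable_integral (Pi.single i 1) 1
  simpa only [NNReal.coe_one, ← mul_occupationTime_eq_integral, one_mul] using h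

variable {Ω : Type*} [MeasurableSpace Ω] {P : Measure Ω} {Q : Matrix (Fin 2) (Fin 2) ℝ}
  {X : ℝ≥0 → Ω → Fin 2}

lemma aemeasurable_occupationTime_cond (hX : IsCTMC Q X P) (i j : Fin 2) :
    AEMeasurable (occupationTime X 0)
      ((ProbabilityTheory.cond P {ω | X 0 ω = i}).restrict {ω | X 1 ω = j}) :=
  (hX.aemeasurable_occupationTime 0).mono_ac
    ((Measure.absolutelyContinuous_of_le Measure.restrict_le_self).trans cond_absolutelyContinuous)

lemma integrable_exp_occupationLaw (hX : IsCTMC Q X P) (i j : Fin 2) (s : ℝ) :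
    Integrable (fun r => Real.exp (s * r)) (occupationLaw P X i j) := by
  have hη := hX.aemeasurable_occupationTime_cond i j
  rw [occupationLaw, integrable_map_measure (by fun_prop) hη]
  exact integrable_exp_mul_of_mem_Icc hη (ae_of_all _ (occupationTime_mem_Icc X 0))

lemma integral_exp_occupationLaw [IsFiniteMeasure P] (hX : IsCTMC Q X P) {i : Fin 2}
    (hi : P {ω | X 0 ω = i} ≠ 0) (j : Fin 2) (s : ℝ) :
    ∫ r, Real.exp (s * r) ∂occupationLaw P X i j =
      (NormedSpace.exp (Q + Matrix.diagonal (Pi.single 0 s)) : Matrix (Fin 2) (Fin 2) ℝ) i j := by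
  have hj : MeasurableSet {ω | X 1 ω = j} := hX.measurable 1 (measurableSet_singleton j)
  have hends : {ω | X 1 ω = j} ∩ {ω | X 0 ω = i} = {ω | X 0 ω = i ∧ X 1 ω = j} := inter_comm _ _
  have hFK := hX.feynmanKac (Pi.single 0 s) 1 i j
  simp only [NNReal.coe_one, ← mul_occupationTime_eq_integral, one_smul] at hFK
  rw [occupationLaw, integral_map (hX.aemeasurable_occupationTime_cond i j) (by fun_prop),
    ProbabilityTheory.cond, Measure.restrict_smul, integral_smul_measure,
    Measure.restrict_restrict hj, hends, hFK, ENNReal.toReal_inv, smul_eq_mul, ← measureReal_def]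
  exact inv_mul_cancel_left₀ ((measureReal_ne_zero_iff (measure_ne_top _ _)).2 hi) _

lemma occupationLaw_eq_of_integral_exp_eq [IsFiniteMeasure P] (hX : IsCTMC Q X P) {i : Fin 2}
    (hi : P {ω | X 0 ω = i} ≠ 0) (j : Fin 2) (ν : Measure ℝ) [IsFiniteMeasure ν]
    (hν : ∀ s : ℝ, ∫ r, Real.exp (s * r) ∂ν =
      (NormedSpace.exp (Q + Matrix.diagonal (Pi.single 0 s)) : Matrix (Fin 2) (Fin 2) ℝ) i j) :
    occupationLaw P X i j = ν := by
  have : IsFiniteMeasure (occupationLaw P X i j) := by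
    unfold occupationLaw
    infer_instance
  exact measure_ext_of_mgf_id_eq (hX.integrable_exp_occupationLaw i j)
    (funext fun s => (hX.integral_exp_occupationLaw hi j s).trans (hν s).symm)

end IsCTMC

end OccupationLaw

section AtomAndDensity

variable {α : Type*} [MeasurableSpace α] {ν : Measure α}

lemma integral_smul_dirac_add_withDensity_ofReal [MeasurableSingletonClass α] {E : Type*}
    [NormedAddCommGroup E] [NormedSpace ℝ E] [CompleteSpace E] {a : ℝ} (ha : 0 ≤ a) (x₀ : α)
    {h : α → ℝ} (hmeas : Measurable h) (hnonneg : 0 ≤ᵐ[ν] h) {f : α → E}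
    (hint : Integrable (fun x => h x • f x) ν) :
    ∫ x, f x ∂(ENNReal.ofReal a • Measure.dirac x₀ + ν.withDensity fun x => ENNReal.ofReal (h x)) =
      a • f x₀ + ∫ x, h x • f x ∂ν := by
  have htoReal : (fun x => (ENNReal.ofReal (h x)).toReal • f x) =ᵐ[ν] fun x => h x • f x :=
    hnonneg.mono fun x hx => by simp only [ENNReal.toReal_ofReal hx]
  have hdirac : Integrable f (ENNReal.ofReal a • Measure.dirac x₀) :=
    (integrable_dirac (by simp)).smul_measure ENNReal.ofReal_ne_top
  have hdensity : Integrable f (ν.withDensity fun x => ENNReal.ofReal (h x)) :=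
    (integrable_withDensity_iff_integrable_smul' hmeas.ennreal_ofReal (by simp)).2
      ((integrable_congr htoReal).2 hint)
  rw [integral_add_measure hdirac hdensity, integral_smul_measure, integral_dirac,
    integral_withDensity_eq_integral_toReal_smul hmeas.ennreal_ofReal (by simp),
    integral_congr_ae htoReal, ENNReal.toReal_ofReal ha]

lemma withDensity_dirac_add_withDensity (x₀ : α) {f g : α → ℝ≥0∞} (hf : Measurable f)
    (hg : Measurable g) :
    (Measure.dirac x₀ + ν.withDensity f).withDensity g =
      g x₀ • Measure.dirac x₀ + ν.withDensity fun x => g x * f x := by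
  rw [withDensity_add_measure, dirac_withDensity' hg, ← withDensity_mul ν hf hg, mul_comm f g]
  rfl

end AtomAndDensity

section TwoStateChain

variable {μ ξ r : ℝ}

/-- The density on `(0, 1)` of the absolutely continuous part of the occupation law of the two-state
chain, as a matrix indexed by the initial and the final state. It is written with
`besselClifford` instead of `besselI` in order to be continuous in `r` up to the endpoints. -/
noncomputable def occupationDensity (μ ξ r : ℝ) : Matrix (Fin 2) (Fin 2) ℝ :=
  Real.exp (-μ * r - ξ * (1 - r)) •
    !![μ * ξ * r * besselClifford 1 (μ * ξ * r * (1 - r)),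
        μ * besselClifford 0 (μ * ξ * r * (1 - r));
      ξ * besselClifford 0 (μ * ξ * r * (1 - r)),
        μ * ξ * (1 - r) * besselClifford 1 (μ * ξ * r * (1 - r))]

lemma continuous_occupationDensity : Continuous (occupationDensity μ ξ) := by
  unfold occupationDensity
  refine Continuous.smul (M := ℝ) (by fun_prop) (continuous_matrix fun i j => ?_)
  fin_cases i <;> fin_cases j <;> dsimp <;> fun_prop

lemma occupationDensity_nonneg (hμ : 0 ≤ μ) (hξ : 0 ≤ ξ) (hr : r ∈ Icc (0 : ℝ) 1) (i j : Fin 2) :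
    0 ≤ occupationDensity μ ξ r i j := by
  obtain ⟨hr0 : 0 ≤ r, hr1 : r ≤ 1⟩ := hr
  replace hr1 : 0 ≤ 1 - r := sub_nonneg.2 hr1
  have hB (p : ℕ) : 0 ≤ besselClifford p (μ * ξ * r * (1 - r)) :=
    besselClifford_nonneg p (by positivity)
  have hB0 := hB 0
  have hB1 := hB 1
  fin_cases i <;> fin_cases j <;> dsimp [occupationDensity] <;> positivity

lemma occupationDensity_eq_besselI (hμ : 0 ≤ μ) (hξ : 0 ≤ ξ) (hr : r ∈ Ioo (0 : ℝ) 1) :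
    occupationDensity μ ξ r = Real.exp (-μ * r - ξ * (1 - r)) •
      !![√(μ * ξ * r / (1 - r)) * besselI 1 (2 * √(μ * ξ * r * (1 - r))),
          μ * besselI 0 (2 * √(μ * ξ * r * (1 - r)));
        ξ * besselI 0 (2 * √(μ * ξ * r * (1 - r))),
          √(μ * ξ * (1 - r) / r) * besselI 1 (2 * √(μ * ξ * r * (1 - r)))] := by
  obtain ⟨hr0 : 0 < r, hr1 : r < 1⟩ := hr
  replace hr1 : 0 < 1 - r := sub_pos.2 hr1
  have hreturn := sqrt_div_mul_besselI_one (a := μ * ξ * (1 - r)) (by positivity) hr0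
  rw [mul_right_comm (μ * ξ) (1 - r) r] at hreturn
  rw [occupationDensity, besselI_two_mul_sqrt 0 (by positivity), pow_zero, one_mul,
    sqrt_div_mul_besselI_one (by positivity) hr1, hreturn]

lemma exp_twoStateGenerator_add_diagonal (μ ξ s : ℝ) (i j : Fin 2) :
    (NormedSpace.exp (twoStateGenerator μ ξ + Matrix.diagonal (Pi.single 0 s)) :
        Matrix (Fin 2) (Fin 2) ℝ) i j =
      Matrix.diagonal ![Real.exp (-μ), Real.exp (-ξ)] i j * Real.exp (s * ![1, 0] i) +
        ∫ r in 0..1, occupationDensity μ ξ r i j * Real.exp (s * r) := by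
  have htilt : twoStateGenerator μ ξ + Matrix.diagonal (Pi.single 0 s) =
      (1 : ℝ) • !![-μ + s, μ; ξ, -ξ] := by
    ext i j
    fin_cases i <;> fin_cases j <;> simp [twoStateGenerator]
  have hexp (r : ℝ) : Real.exp ((-μ + s) * r + -ξ * (1 - r)) =
      Real.exp (-μ * r - ξ * (1 - r)) * Real.exp (s * r) := by
    rw [← Real.exp_add]
    ring_nf
  have h00 : returnIntegral (-μ + s) (-ξ) (μ * ξ) 1 = Real.exp (-μ) * Real.exp s +
      ∫ r in 0..1, occupationDensity μ ξ r 0 0 * Real.exp (s * r) := by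
    simp only [returnIntegral_eq_reflect, mul_one, Real.exp_add (-μ), hexp]
    congr! 3
    simp [occupationDensity]
    ring
  have h01 : μ * switchIntegral (-μ + s) (-ξ) (μ * ξ) 1 =
      ∫ r in 0..1, occupationDensity μ ξ r 0 1 * Real.exp (s * r) := by
    simp only [switchIntegral, hexp, ← intervalIntegral.integral_const_mul]
    congr! 2
    simp [occupationDensity]
    ring
  have h10 : ξ * switchIntegral (-μ + s) (-ξ) (μ * ξ) 1 =
      ∫ r in 0..1, occupationDensity μ ξ r 1 0 * Real.exp (s * r) := by
    simp only [switchIntegral, hexp, ← intervalIntegral.integral_const_mul]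
    congr! 2
    simp [occupationDensity]
    ring
  have h11 : returnIntegral (-ξ) (-μ + s) (μ * ξ) 1 = Real.exp (-ξ) +
      ∫ r in 0..1, occupationDensity μ ξ r 1 1 * Real.exp (s * r) := by
    simp only [returnIntegral, mul_one, hexp]
    congr! 3
    simp [occupationDensity]
    ring
  rw [htilt, exp_smul_two_by_two]
  fin_cases i <;> fin_cases j <;> simp [h00, h01, h10, h11]

variable {Ω : Type*} [MeasurableSpace Ω] {P : Measure Ω} {X : ℝ≥0 → Ω → Fin 2}

theorem IsCTMC.occupationLaw_eq [IsFiniteMeasure P] (hX : IsCTMC (twoStateGenerator μ ξ) X P)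
    {i : Fin 2} (hi : P {ω | X 0 ω = i} ≠ 0) (j : Fin 2) :
    occupationLaw P X i j =
      ENNReal.ofReal (Matrix.diagonal ![Real.exp (-μ), Real.exp (-ξ)] i j) •
          Measure.dirac (![1, 0] i) +
        (volume.restrict (Ioo (0 : ℝ) 1)).withDensity fun r =>
          ENNReal.ofReal (occupationDensity μ ξ r i j) := by
  have hμ : 0 ≤ μ := hX.generator.offDiag_nonneg 0 1 (by simp)
  have hξ : 0 ≤ ξ := hX.generator.offDiag_nonneg 1 0 (by simp)
  have hcont : Continuous fun r => occupationDensity μ ξ r i j :=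
    continuous_occupationDensity.matrix_elem i j
  have hatom : 0 ≤ Matrix.diagonal ![Real.exp (-μ), Real.exp (-ξ)] i j := by
    fin_cases i <;> fin_cases j <;> simp [Real.exp_nonneg]
  have hint {f : ℝ → ℝ} (hf : Continuous f) : IntegrableOn f (Ioo 0 1) :=
    (hf.integrableOn_Icc (a := 0) (b := 1)).mono_set Ioo_subset_Icc_self
  have := isFiniteMeasure_withDensity_ofReal (hint hcont).2
  have := Measure.smul_finite (Measure.dirac (![(1 : ℝ), 0] i))
    (ENNReal.ofReal_ne_top (r := Matrix.diagonal ![Real.exp (-μ), Real.exp (-ξ)] i j))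
  refine hX.occupationLaw_eq_of_integral_exp_eq hi j _ fun s => ?_
  rw [integral_smul_dirac_add_withDensity_ofReal hatom _ hcont.measurable
    (ae_restrict_of_forall_mem measurableSet_Ioo fun r hr =>
      occupationDensity_nonneg hμ hξ (Ioo_subset_Icc_self hr) i j)
    (hint (by fun_prop)), exp_twoStateGenerator_add_diagonal,
    intervalIntegral.integral_of_le zero_le_one, integral_Ioc_eq_integral_Ioo]
  rfl

end TwoStateChain

theorem mainTheorem8 {Ω : Type*} [MeasurableSpace Ω] (P : Measure Ω) [IsProbabilityMeasure P]
    (μ ξ : ℝ) (hμ : 0 < μ) (hξ : 0 < ξ) (X : ℝ≥0 → Ω → Fin 2)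
    (hX : IsCTMC (twoStateGenerator μ ξ) X P) :
    (P {ω | X 0 ω = 0} ≠ 0 →
      occupationLaw P X 0 0 =
          (Measure.dirac (1 : ℝ) +
            (volume.restrict (Ioo (0 : ℝ) 1)).withDensity (fun r =>
              ENNReal.ofReal (Real.sqrt (μ * ξ * r / (1 - r)) *
                besselI 1 (2 * Real.sqrt (μ * ξ * r * (1 - r)))))).withDensity
            (fun r => ENNReal.ofReal (Real.exp (-μ * r - ξ * (1 - r)))) ∧
      occupationLaw P X 0 1 =
          (volume.restrict (Ioo (0 : ℝ) 1)).withDensity (fun r =>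
            ENNReal.ofReal (μ * Real.exp (-μ * r - ξ * (1 - r)) *
              besselI 0 (2 * Real.sqrt (μ * ξ * r * (1 - r)))))) ∧
    (P {ω | X 0 ω = 1} ≠ 0 →
      occupationLaw P X 1 0 =
          (volume.restrict (Ioo (0 : ℝ) 1)).withDensity (fun r =>
            ENNReal.ofReal (ξ * Real.exp (-μ * r - ξ * (1 - r)) *
              besselI 0 (2 * Real.sqrt (μ * ξ * r * (1 - r))))) ∧
      occupationLaw P X 1 1 =
          (Measure.dirac (0 : ℝ) +
            (volume.restrict (Ioo (0 : ℝ) 1)).withDensity (fun r =>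
              ENNReal.ofReal (Real.sqrt (μ * ξ * (1 - r) / r) *
                besselI 1 (2 * Real.sqrt (μ * ξ * r * (1 - r)))))).withDensity
            (fun r => ENNReal.ofReal (Real.exp (-μ * r - ξ * (1 - r))))) := by
  have hdensity {r : ℝ} (hr : r ∈ Ioo (0 : ℝ) 1) := occupationDensity_eq_besselI hμ.le hξ.le hr
  refine ⟨fun h0 => ⟨?_, ?_⟩, fun h1 => ⟨?_, ?_⟩⟩
  · rw [hX.occupationLaw_eq h0, withDensity_dirac_add_withDensity _ (by fun_prop) (by fun_prop)]
    congr 1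
    · simp
    · exact withDensity_congr_ae (ae_restrict_of_forall_mem measurableSet_Ioo fun r hr => by
        simp [hdensity hr, ENNReal.ofReal_mul, Real.exp_nonneg])
  · rw [hX.occupationLaw_eq h0, Matrix.diagonal_apply_ne _ zero_ne_one, ENNReal.ofReal_zero,
      zero_smul, zero_add]
    exact withDensity_congr_ae (ae_restrict_of_forall_mem measurableSet_Ioo fun r hr => by
        simp [hdensity hr, mul_left_comm, mul_assoc])
  · rw [hX.occupationLaw_eq h1, Matrix.diagonal_apply_ne _ one_ne_zero, ENNReal.ofReal_zero,
      zero_smul, zero_add]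
    exact withDensity_congr_ae (ae_restrict_of_forall_mem measurableSet_Ioo fun r hr => by
        simp [hdensity hr, mul_left_comm, mul_assoc])
  · rw [hX.occupationLaw_eq h1, withDensity_dirac_add_withDensity _ (by fun_prop) (by fun_prop)]
    congr 1
    · simp
    · exact withDensity_congr_ae (ae_restrict_of_forall_mem measurableSet_Ioo fun r hr => by
        simp [hdensity hr, ENNReal.ofReal_mul, Real.exp_nonneg])
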